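/- Let $A\in\mathbb R^{n\times n}$, $B\in\mathbb R^{n\times s}$, $C\in\mathbb R^{p\times n}$, $Z\in\mathbb R^{n\times q}$. Call a real square matrix stable if all its complex eigenvalues have negative real part. Assume that $(A,B)$ is stabilizable ($A-BK$ is stable for some $K\in\mathbb R^{s\times n}$) and that $(C,A)$ is detectable ($(A^T,C^T)$ is stabilizable). Let $\mathcal V\in\mathbb R^{n\times d}$ be a matrix with orthonormal columns (for instance an orthonormal basis of a polynomial, extended or rational Krylov subspace after $m_*$ iterations) such that $\dim(\operatorname{range}\mathcal V)=n$. Put $\mathcal T=\mathcal V^TA\mathcal V$, $\widehat B=\mathcal V^TB$, $\widehat C=C\mathcal V$, $\widehat Z=\mathcal V^TZ$. Then: 1. The algebraic Riccati equation $$0=A^TX+XA-XBB^TX+C^TC$$ has a solution $X_\infty$ that is symmetric nonnegative definite and stabilizing, i.e. $A-BB^TX_\infty$ is stable, and $X_\infty$ is its only symmetric nonnegative definite solution. 2. The projected differential Riccati equation $$\dot Y(t)=\mathcal T^TY(t)+Y(t)\mathcal T-Y(t)\widehat B\widehat B^TY(t)+\widehat C^T\widehat C,\qquad Y(0)=\widehat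 Z\widehat Z^T,$$ has a solution on $[0,\infty)$, and all of its solutions on $[0,\infty)$ converge, as $t\to\infty$, to one and the same matrix $Y^\infty$. 3. The projected steady-state approximation is exact: $\mathcal V\,Y^\infty\,\mathcal V^T=X_\infty$. -/

import Mathlib

open scoped Matrix

namespace Riccati

variable {n s p q : ℕ}

/-- A real square matrix is stable (Hurwitz) if all its complex eigenvalues lie in the open
left half plane. -/
def IsStable (A : Matrix (Fin n) (Fin n) ℝ) : Prop :=
  ∀ μ ∈ spectrum ℂ (A.map (algebraMap ℝ ℂ)), μ.re < 0

/-- `(A, B)` is stabilizable: some state feedback `u = -K x` makes `A - B K` stable. -/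
def IsStabilizable (A : Matrix (Fin n) (Fin n) ℝ) (B : Matrix (Fin n) (Fin s) ℝ) : Prop :=
  ∃ K : Matrix (Fin s) (Fin n) ℝ, IsStable (A - B * K)

/-- `(C, A)` is detectable: the dual pair `(Aᵀ, Cᵀ)` is stabilizable. -/
def IsDetectable (C : Matrix (Fin p) (Fin n) ℝ) (A : Matrix (Fin n) (Fin n) ℝ) : Prop :=
  IsStabilizable Aᵀ Cᵀ

/-- The Riccati operator `X ↦ Aᵀ X + X A - X B Bᵀ X + Cᵀ C`. -/
def riccati (A : Matrix (Fin n) (Fin n) ℝ) (B : Matrix (Fin n) (Fin s) ℝ)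
    (C : Matrix (Fin p) (Fin n) ℝ) (X : Matrix (Fin n) (Fin n) ℝ) : Matrix (Fin n) (Fin n) ℝ :=
  Aᵀ * X + X * A - X * B * Bᵀ * X + Cᵀ * C

/-- `X` solves the algebraic Riccati equation. -/
def IsAlgebraicSolution (A : Matrix (Fin n) (Fin n) ℝ) (B : Matrix (Fin n) (Fin s) ℝ)
    (C : Matrix (Fin p) (Fin n) ℝ) (X : Matrix (Fin n) (Fin n) ℝ) : Prop :=
  riccati A B C X = 0

/-- `X` is stabilizing: the closed-loop matrix `A - B Bᵀ X` is stable. -/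
def IsStabilizing (A : Matrix (Fin n) (Fin n) ℝ) (B : Matrix (Fin n) (Fin s) ℝ)
    (X : Matrix (Fin n) (Fin n) ℝ) : Prop :=
  IsStable (A - B * Bᵀ * X)

/-- `Y` solves, on `[0, ∞)`, the differential Riccati equation with initial value `Z Zᵀ`
(one-sided derivative at `0`; the values of `Y` at negative times are irrelevant). -/
def IsDifferentialSolution (A : Matrix (Fin n) (Fin n) ℝ) (B : Matrix (Fin n) (Fin s) ℝ)
    (C : Matrix (Fin p) (Fin n) ℝ) (Z : Matrix (Fin n) (Fin q) ℝ)
    (Y : ℝ → Matrix (Fin n) (Fin n) ℝ) : Prop :=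
  Y 0 = Z * Zᵀ ∧
    ∀ t : ℝ, 0 ≤ t → ∀ i j, HasDerivWithinAt (fun τ => Y τ i j) (riccati A B C (Y t) i j)
      (Set.Ici 0) t

end Riccati

/-! Orthonormal columns together with rank `n` make `V` a square orthogonal matrix, so the projected
equation is the full one in rotated coordinates. What remains is the asymptotics of the full
equation, `exists_stabilizing_attractor`.

Global existence comes from linearization. A linear Hamiltonian flow `(U, W)` yields the Riccati
solution `W U⁻¹`, and monotonicity of `Uᵀ W` keeps `U` invertible (`isUnit_flow`).

The solution `P` started at zero is nondecreasing, because its residual `riccati A B C P` obeys a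
homogeneous Lyapunov equation and starts at `Cᵀ C`. It is bounded by the Lyapunov solution attached
to a stabilizing feedback. Hence it converges to some nonnegative definite `L`, which solves the
algebraic equation. Detectability makes every such solution stabilizing, and the difference of two
stabilizing ones solves a homogeneous Sylvester equation with stable coefficients, hence vanishes.

With `F = A - B Bᵀ L`, any solution `X` with nonnegative definite start is squeezed, as a quadratic
form, between `P t` and `L + exp(tF)ᵀ (X 0 - L) exp(tF)`. Both tend to `L`. -/

namespace Riccati

/-! ### Entrywise calculus of matrix functions on the half line. -/

open Filter Topology

/-- Entrywise derivative of a matrix-valued function, relative to the half line `[0, ∞)`. -/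
def HasMatrixDeriv {m n : Type*} (M : ℝ → Matrix m n ℝ) (M' : Matrix m n ℝ) (t : ℝ) : Prop :=
  ∀ i j, HasDerivWithinAt (fun τ => M τ i j) (M' i j) (Set.Ici 0) t

namespace HasMatrixDeriv

variable {l m n : Type*} {M : ℝ → Matrix l m ℝ} {M' : Matrix l m ℝ}
  {N : ℝ → Matrix m n ℝ} {N' : Matrix m n ℝ}
  {P : ℝ → Matrix l m ℝ} {P' : Matrix l m ℝ} {t : ℝ}

theorem const (A : Matrix l m ℝ) (t : ℝ) : HasMatrixDeriv (fun _ => A) 0 t :=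
  fun i j => hasDerivWithinAt_const t _ (A i j)

theorem add (hM : HasMatrixDeriv M M' t) (hP : HasMatrixDeriv P P' t) :
    HasMatrixDeriv (fun τ => M τ + P τ) (M' + P') t :=
  fun i j => (hM i j).add (hP i j)

theorem sub (hM : HasMatrixDeriv M M' t) (hP : HasMatrixDeriv P P' t) :
    HasMatrixDeriv (fun τ => M τ - P τ) (M' - P') t :=
  fun i j => (hM i j).sub (hP i j)

theorem neg (hM : HasMatrixDeriv M M' t) : HasMatrixDeriv (fun τ => -M τ) (-M') t :=
  fun i j => (hM i j).neg

theorem transpose (hM : HasMatrixDeriv M M' t) : HasMatrixDeriv (fun τ => (M τ)ᵀ) M'ᵀ t :=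
  fun i j => hM j i

theorem mul [Fintype m] (hM : HasMatrixDeriv M M' t) (hN : HasMatrixDeriv N N' t) :
    HasMatrixDeriv (fun τ => M τ * N τ) (M' * N t + M t * N') t := by
  intro i j
  have h := HasDerivWithinAt.fun_sum (u := Finset.univ) fun k _ => (hM i k).mul (hN k j)
  simpa [Matrix.mul_apply, Finset.sum_add_distrib] using h

theorem const_mul {k : Type*} [Fintype l] (A : Matrix k l ℝ) (hM : HasMatrixDeriv M M' t) :
    HasMatrixDeriv (fun τ => A * M τ) (A * M') t := by
  simpa using (const A t).mul hM

theorem mul_const {k : Type*} [Fintype m] (hM : HasMatrixDeriv M M' t) (A : Matrix m k ℝ) :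
    HasMatrixDeriv (fun τ => M τ * A) (M' * A) t := by
  simpa using hM.mul (const A t)

theorem congr_deriv (hM : HasMatrixDeriv M M' t) (h : M' = P') : HasMatrixDeriv M P' t := h ▸ hM

-- The bridge to a submultiplicative norm, through which normed-algebra facts about inverses,
-- exponentials and Grönwall bounds become available.
open scoped Matrix.Norms.Operator in
theorem iff_hasDerivWithinAt [Fintype l] [Fintype m] :
    HasMatrixDeriv M M' t ↔ HasDerivWithinAt M M' (Set.Ici 0) t := by
  unfold HasMatrixDeriv
  refine Iff.symm (Iff.trans (hasDerivWithinAt_pi (φ := M) (φ' := M')) ?_)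
  refine forall_congr' fun i => ?_
  exact hasDerivWithinAt_pi

theorem continuousWithinAt (hM : HasMatrixDeriv M M' t) :
    ContinuousWithinAt M (Set.Ici 0) t :=
  continuousWithinAt_pi.2 fun i => continuousWithinAt_pi.2 fun j => (hM i j).continuousWithinAt

open scoped Matrix.Norms.Operator in
theorem inv [Fintype n] [DecidableEq n] {U : ℝ → Matrix n n ℝ} {U' : Matrix n n ℝ}
    (hU : HasMatrixDeriv U U' t) (hunit : IsUnit (U t)) :
    HasMatrixDeriv (fun τ => (U τ)⁻¹) (-((U t)⁻¹ * U' * (U t)⁻¹)) t := by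
  rw [iff_hasDerivWithinAt] at hU ⊢
  obtain ⟨u, hu⟩ := hunit
  have h := hasFDerivAt_ringInverse (𝕜 := ℝ) u
  rw [hu] at h
  have h2 := h.comp_hasDerivWithinAt t hU
  have h3 : ((u⁻¹ : (Matrix n n ℝ)ˣ) : Matrix n n ℝ) = (U t)⁻¹ := by
    rw [← hu, Matrix.coe_units_inv]
  rw [h3] at h2
  have h4 : (fun τ => (U τ)⁻¹) = Ring.inverse ∘ U :=
    funext fun τ => Matrix.nonsing_inv_eq_ringInverse _
  rw [h4]
  refine h2.congr_deriv ?_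
  simp

theorem exp_smul [Fintype n] [DecidableEq n] (A : Matrix n n ℝ) (t : ℝ) :
    HasMatrixDeriv (fun τ => NormedSpace.exp (τ • A)) (A * NormedSpace.exp (t • A)) t := by
  open scoped Matrix.Norms.Operator in
  exact iff_hasDerivWithinAt.2 (hasDerivAt_exp_smul_const' (𝕂 := ℝ) A t).hasDerivWithinAt

end HasMatrixDeriv

theorem exp_smul_mul_comm {n : ℕ} (A : Matrix (Fin n) (Fin n) ℝ) (t : ℝ) :
    A * NormedSpace.exp (t • A) = NormedSpace.exp (t • A) * A :=
  (((Commute.refl A).smul_right t).exp_right).eq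

/-- A matrix function with vanishing derivative on `[0, ∞)` is constant there. -/
theorem eq_of_hasMatrixDeriv_zero {m n : ℕ} {M : ℝ → Matrix (Fin m) (Fin n) ℝ}
    (hM : ∀ t, 0 ≤ t → HasMatrixDeriv M 0 t) {t : ℝ} (ht : 0 ≤ t) : M t = M 0 := by
  ext i j
  refine (convex_Ici (0 : ℝ)).is_const_of_fderivWithin_eq_zero (𝕜 := ℝ) (f := fun τ => M τ i j)
    (fun τ hτ => (hM τ hτ i j).differentiableWithinAt) (fun τ hτ => ?_) ht (Set.self_mem_Ici)
  have h := (hM τ hτ i j).hasFDerivWithinAt.fderivWithin (uniqueDiffOn_Ici (0 : ℝ) τ hτ)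
  rw [h]
  ext
  simp

/-- The quadratic form of a matrix. -/
def quad {n : ℕ} (M : Matrix (Fin n) (Fin n) ℝ) (x : Fin n → ℝ) : ℝ := x ⬝ᵥ M *ᵥ x

/-! ### Quadratic forms: monotonicity and convergence. -/

section quad

variable {n : ℕ}

theorem quad_add (M N : Matrix (Fin n) (Fin n) ℝ) (x : Fin n → ℝ) :
    quad (M + N) x = quad M x + quad N x := by
  simp [quad, Matrix.add_mulVec]

theorem quad_sub (M N : Matrix (Fin n) (Fin n) ℝ) (x : Fin n → ℝ) :
    quad (M - N) x = quad M x - quad N x := by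
  simp [quad, Matrix.sub_mulVec]

theorem quad_neg (M : Matrix (Fin n) (Fin n) ℝ) (x : Fin n → ℝ) :
    quad (-M) x = -quad M x := by
  simp [quad, Matrix.neg_mulVec]

theorem quad_conj {m : ℕ} (M : Matrix (Fin m) (Fin m) ℝ) (U : Matrix (Fin m) (Fin n) ℝ)
    (x : Fin n → ℝ) : quad (Uᵀ * M * U) x = quad M (U *ᵥ x) := by
  simp only [quad]
  rw [← Matrix.mulVec_mulVec, ← Matrix.mulVec_mulVec, Matrix.dotProduct_mulVec,
    Matrix.vecMul_transpose]

theorem quad_transpose_mul_self {m : ℕ} (C : Matrix (Fin m) (Fin n) ℝ) (x : Fin n → ℝ) :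
    quad (Cᵀ * C) x = (C *ᵥ x) ⬝ᵥ (C *ᵥ x) := by
  simp only [quad]
  rw [← Matrix.mulVec_mulVec, Matrix.dotProduct_mulVec, Matrix.vecMul_transpose]

theorem quad_transpose_mul_self_nonneg {m : ℕ} (C : Matrix (Fin m) (Fin n) ℝ) (x : Fin n → ℝ) :
    0 ≤ quad (Cᵀ * C) x := by
  rw [quad_transpose_mul_self]
  simpa using dotProduct_star_self_nonneg (C *ᵥ x)

theorem posSemidef_iff_quad {M : Matrix (Fin n) (Fin n) ℝ} :
    M.PosSemidef ↔ Mᵀ = M ∧ ∀ x, 0 ≤ quad M x := by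
  rw [Matrix.posSemidef_iff_dotProduct_mulVec]
  rfl

theorem quad_eq_sum (M : Matrix (Fin n) (Fin n) ℝ) (x : Fin n → ℝ) :
    quad M x = ∑ i, ∑ j, x i * M i j * x j := by
  simp [quad, dotProduct, Matrix.mulVec, Finset.mul_sum, mul_assoc]

theorem hasDerivWithinAt_quad {M : ℝ → Matrix (Fin n) (Fin n) ℝ} {M' : Matrix (Fin n) (Fin n) ℝ}
    {t : ℝ} (hM : HasMatrixDeriv M M' t) (x : Fin n → ℝ) :
    HasDerivWithinAt (fun τ => quad (M τ) x) (quad M' x) (Set.Ici 0) t := by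
  simp only [quad_eq_sum]
  exact HasDerivWithinAt.fun_sum fun i _ => HasDerivWithinAt.fun_sum fun j _ =>
    ((hM i j).const_mul (x i)).mul_const (x j)

theorem monotoneOn_quad {M M' : ℝ → Matrix (Fin n) (Fin n) ℝ}
    (hM : ∀ t, 0 ≤ t → HasMatrixDeriv M (M' t) t) {x : Fin n → ℝ}
    (h : ∀ t, 0 ≤ t → 0 ≤ quad (M' t) x) :
    MonotoneOn (fun τ => quad (M τ) x) (Set.Ici 0) := by
  refine monotoneOn_of_hasDerivWithinAt_nonneg (f' := fun t => quad (M' t) x) (convex_Ici 0)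
    (fun t ht => (hasDerivWithinAt_quad (hM t ht) x).continuousWithinAt)
    (fun t ht => ?_) (fun t ht => ?_)
  · exact (hasDerivWithinAt_quad (hM t (interior_subset ht)) x).mono interior_subset
  · exact h t (interior_subset ht)

theorem quad_le_quad_of_deriv_nonneg {M M' : ℝ → Matrix (Fin n) (Fin n) ℝ}
    (hM : ∀ t, 0 ≤ t → HasMatrixDeriv M (M' t) t) {x : Fin n → ℝ}
    (h : ∀ t, 0 ≤ t → 0 ≤ quad (M' t) x) {t : ℝ} (ht : 0 ≤ t) :
    quad (M 0) x ≤ quad (M t) x :=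
  monotoneOn_quad hM h Set.self_mem_Ici ht ht

/-- Polarization. -/
theorem apply_eq_quad {M : Matrix (Fin n) (Fin n) ℝ} (hM : Mᵀ = M) (i j : Fin n) :
    M i j = (quad M (Pi.single i 1 + Pi.single j 1) - quad M (Pi.single i 1)
      - quad M (Pi.single j 1)) / 2 := by
  have h : M j i = M i j := congrFun (congrFun hM i) j
  simp [quad, Matrix.mulVec_add, h]
  ring

/-- Symmetric matrices converge as soon as their quadratic forms do. -/
theorem exists_tendsto_of_quad {M : ℝ → Matrix (Fin n) (Fin n) ℝ}
    (hM : ∀ t, 0 ≤ t → (M t)ᵀ = M t)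
    (h : ∀ x, ∃ l, Tendsto (fun t => quad (M t) x) atTop (𝓝 l)) :
    ∃ L, Tendsto M atTop (𝓝 L) := by
  choose l hl using h
  refine ⟨fun i j => (l (Pi.single i 1 + Pi.single j 1) - l (Pi.single i 1)
    - l (Pi.single j 1)) / 2, ?_⟩
  refine tendsto_pi_nhds.2 fun i => tendsto_pi_nhds.2 fun j => ?_
  refine Tendsto.congr' ?_ ((((hl (Pi.single i 1 + Pi.single j 1)).sub (hl (Pi.single i 1))).sub
    (hl (Pi.single j 1))).div_const 2)
  filter_upwards [eventually_ge_atTop 0] with t ht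
  exact (apply_eq_quad (hM t ht) i j).symm

theorem continuous_quad (x : Fin n → ℝ) :
    Continuous fun M : Matrix (Fin n) (Fin n) ℝ => quad M x := by
  unfold quad
  fun_prop

theorem tendsto_of_tendsto_quad {M : ℝ → Matrix (Fin n) (Fin n) ℝ} {L : Matrix (Fin n) (Fin n) ℝ}
    (hM : ∀ t, 0 ≤ t → (M t)ᵀ = M t) (hL : Lᵀ = L)
    (h : ∀ x, Tendsto (fun t => quad (M t) x) atTop (𝓝 (quad L x))) :
    Tendsto M atTop (𝓝 L) := by
  refine tendsto_pi_nhds.2 fun i => tendsto_pi_nhds.2 fun j => ?_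
  rw [apply_eq_quad hL i j]
  refine Tendsto.congr' ?_ ((((h (Pi.single i 1 + Pi.single j 1)).sub (h (Pi.single i 1))).sub
    (h (Pi.single j 1))).div_const 2)
  filter_upwards [eventually_ge_atTop 0] with t ht
  exact (apply_eq_quad (hM t ht) i j).symm

end quad

end Riccati

/-! ### Decay of the exponential of a stable matrix. -/

namespace Riccati

open Filter Topology

theorem tendsto_pow_mul_exp_of_re_neg {μ : ℂ} (hμ : μ.re < 0) (k : ℕ) :
    Tendsto (fun t : ℝ => (t : ℂ) ^ k * Complex.exp (t * μ)) atTop (𝓝 0) := by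
  rw [tendsto_zero_iff_norm_tendsto_zero]
  have h := Real.tendsto_pow_mul_exp_neg_atTop_nhds_zero k
  have h2 : Tendsto (fun t : ℝ => (-μ.re) * t) atTop atTop :=
    tendsto_id.const_mul_atTop (neg_pos.2 hμ)
  have h3 := (h.comp h2).const_mul (((-μ.re) ^ k)⁻¹)
  rw [mul_zero] at h3
  refine h3.congr' ?_
  filter_upwards [eventually_ge_atTop 0] with t ht
  have : (-μ.re) ^ k ≠ 0 := pow_ne_zero _ (by linarith)
  simp only [Function.comp, norm_mul, norm_pow, Complex.norm_real, Complex.norm_exp,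
    Real.norm_of_nonneg ht, Complex.mul_re, Complex.ofReal_re, Complex.ofReal_im, zero_mul, sub_zero]
  rw [mul_pow, mul_assoc, inv_mul_cancel_left₀ this]
  congr 2
  ring

theorem hasSum_exp {n : ℕ} (N : Matrix (Fin n) (Fin n) ℂ) :
    HasSum (fun k : ℕ => (k.factorial : ℂ)⁻¹ • N ^ k) (NormedSpace.exp N) := by
  open scoped Matrix.Norms.Operator in
  exact NormedSpace.exp_series_hasSum_exp' (𝕂 := ℂ) N

theorem exp_smul_one {n : ℕ} (z : ℂ) :
    NormedSpace.exp (z • (1 : Matrix (Fin n) (Fin n) ℂ)) = Complex.exp z • 1 := by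
  rw [Matrix.smul_one_eq_diagonal, Matrix.smul_one_eq_diagonal, Matrix.exp_diagonal,
    Complex.exp_eq_exp_ℂ]
  congr 1
  funext i
  rw [Pi.coe_exp]

/-- The exponential series terminates on a vector killed by a power of `N`. -/
theorem exp_mulVec_eq_sum {n : ℕ} (N : Matrix (Fin n) (Fin n) ℂ) {v : Fin n → ℂ} {k : ℕ}
    (hk : (N ^ k) *ᵥ v = 0) (t : ℝ) :
    NormedSpace.exp (t • N) *ᵥ v
      = ∑ j ∈ Finset.range k, ((t : ℂ) ^ j * (j.factorial : ℂ)⁻¹) • ((N ^ j) *ᵥ v) := by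
  have h := hasSum_exp (t • N)
  have hc : Continuous (fun M : Matrix (Fin n) (Fin n) ℂ => M *ᵥ v) := by fun_prop
  have h2 := h.map ((Matrix.mulVecBilin ℂ ℂ).flip v : Matrix (Fin n) (Fin n) ℂ →ₗ[ℂ] (Fin n → ℂ)) hc
  refine h2.unique ?_
  have hterm : ∀ j : ℕ, (((j.factorial : ℂ)⁻¹) • (t • N) ^ j) *ᵥ v =
      ((t : ℂ) ^ j * (j.factorial : ℂ)⁻¹) • ((N ^ j) *ᵥ v) := by
    intro j
    rw [smul_pow, Matrix.smul_mulVec, Matrix.smul_mulVec, mul_comm, mul_smul]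
    congr 1
    rw [← Complex.ofReal_pow, Complex.coe_smul]
  suffices HasSum (fun j => ((t : ℂ) ^ j * (j.factorial : ℂ)⁻¹) • ((N ^ j) *ᵥ v))
      (∑ j ∈ Finset.range k, ((t : ℂ) ^ j * (j.factorial : ℂ)⁻¹) • ((N ^ j) *ᵥ v)) by
    convert this using 1
    funext j
    exact hterm j
  refine hasSum_sum_of_ne_finset_zero fun j hj => ?_
  have hj : k ≤ j := by simpa using hj
  obtain ⟨i, rfl⟩ := Nat.exists_eq_add_of_le' hj
  rw [pow_add N, ← Matrix.mulVec_mulVec, hk, Matrix.mulVec_zero, smul_zero]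

/-- Splits `A` into the commuting summands `μ • 1` and `A - μ • 1`, the second being nilpotent on
`v`. -/
theorem exp_smul_mulVec_of_generalized {n : ℕ} (A : Matrix (Fin n) (Fin n) ℂ) (μ : ℂ)
    {v : Fin n → ℂ} {k : ℕ} (hk : ((A - μ • 1) ^ k) *ᵥ v = 0) (t : ℝ) :
    NormedSpace.exp (t • A) *ᵥ v = ∑ j ∈ Finset.range k,
      (((t : ℂ) ^ j * Complex.exp (t * μ)) * (j.factorial : ℂ)⁻¹) •
        (((A - μ • 1) ^ j) *ᵥ v) := by
  have hA : t • A = (t * μ) • (1 : Matrix (Fin n) (Fin n) ℂ) + t • (A - μ • 1) := by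
    rw [smul_sub, ← Complex.coe_smul t (μ • (1 : Matrix (Fin n) (Fin n) ℂ)), smul_smul]
    abel
  have hcomm : Commute ((t * μ) • (1 : Matrix (Fin n) (Fin n) ℂ)) (t • (A - μ • 1)) :=
    (Commute.one_left _).smul_left _
  rw [hA, Matrix.exp_add_of_commute _ _ hcomm, exp_smul_one, smul_mul_assoc, one_mul, Matrix.smul_mulVec,
    exp_mulVec_eq_sum _ hk, Finset.smul_sum]
  refine Finset.sum_congr rfl fun j _ => ?_
  rw [smul_smul]
  congr 1
  ring

/-- Over `ℂ` the generalized eigenspaces span, and on each of them the exponential is a polynomial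
in `t` times `exp (t μ)`. -/
theorem tendsto_exp_smul_mulVec {n : ℕ} {A : Matrix (Fin n) (Fin n) ℂ}
    (hA : ∀ μ ∈ spectrum ℂ A, μ.re < 0) (v : Fin n → ℂ) :
    Tendsto (fun t : ℝ => NormedSpace.exp (t • A) *ᵥ v) atTop (𝓝 0) := by
  have hv : v ∈ ⨆ μ, Module.End.maxGenEigenspace (Matrix.toLin' A) μ := by
    rw [Module.End.iSup_maxGenEigenspace_eq_top]
    trivial
  induction hv using Submodule.iSup_induction' with
  | zero => simp
  | add x y _ _ hx hy => simpa [Matrix.mulVec_add] using hx.add hy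
  | mem μ x hx =>
    rw [Module.End.mem_maxGenEigenspace] at hx
    obtain ⟨k, hk⟩ := hx
    have hk' : ((A - μ • 1) ^ k) *ᵥ x = 0 := by
      have : (Matrix.toLin' A - μ • (1 : Module.End ℂ (Fin n → ℂ))) ^ k
          = Matrix.toLin' ((A - μ • 1) ^ k) := by
        rw [Matrix.toLin'_pow, map_sub, map_smul, Matrix.toLin'_one]
        rfl
      rwa [this, Matrix.toLin'_apply] at hk
    by_cases hμ : μ ∈ spectrum ℂ A
    · simp_rw [exp_smul_mulVec_of_generalized A μ hk']
      rw [← Finset.sum_const_zero (s := Finset.range k)]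
      refine tendsto_finsetSum _ fun j _ => ?_
      have := ((tendsto_pow_mul_exp_of_re_neg (hA μ hμ) j).mul_const
        ((j.factorial : ℂ)⁻¹)).smul_const (((A - μ • 1) ^ j) *ᵥ x)
      simpa using this
    -- Off the spectrum the generalized eigenspace is trivial.
    · have hu : IsUnit (A - μ • 1) := by
        rw [spectrum.notMem_iff, Algebra.algebraMap_eq_smul_one] at hμ
        simpa using hμ.neg
      have hx0 : x = 0 := by
        refine Matrix.mulVec_injective_of_isUnit (hu.pow k) ?_
        rw [hk', Matrix.mulVec_zero]
      simp [hx0]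

theorem map_exp_smul {n : ℕ} (F : Matrix (Fin n) (Fin n) ℝ) (t : ℝ) :
    (NormedSpace.exp (t • F)).map (algebraMap ℝ ℂ)
      = NormedSpace.exp (t • F.map (algebraMap ℝ ℂ)) := by
  have h : (t • F).map (algebraMap ℝ ℂ) = t • F.map (algebraMap ℝ ℂ) := by
    ext i j
    simp
  rw [← h]
  open scoped Matrix.Norms.Operator in
  exact NormedSpace.map_exp (algebraMap ℝ ℂ).mapMatrix
    (Continuous.matrix_map continuous_id Complex.continuous_ofReal) (t • F)

theorem IsStable.tendsto_exp {n : ℕ} {F : Matrix (Fin n) (Fin n) ℝ} (hF : IsStable F) :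
    Tendsto (fun t : ℝ => NormedSpace.exp (t • F)) atTop (𝓝 0) := by
  refine tendsto_pi_nhds.2 fun i => tendsto_pi_nhds.2 fun j => ?_
  have h := tendsto_pi_nhds.1 (tendsto_exp_smul_mulVec hF (Pi.single j 1)) i
  have h2 := (Complex.continuous_re.tendsto _).comp h
  refine h2.congr fun t => ?_
  rw [Function.comp_apply, ← map_exp_smul]
  simp

end Riccati

/-! ### Sylvester, Lyapunov and algebraic Riccati equations. -/

namespace Riccati

open Filter Topology

variable {n : ℕ}

theorem tendsto_transpose_mul_mul {ι : Type*} {l : Filter ι} {f g : ι → Matrix (Fin n) (Fin n) ℝ}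
    (hf : Tendsto f l (𝓝 0)) (hg : Tendsto g l (𝓝 0)) (E : Matrix (Fin n) (Fin n) ℝ) :
    Tendsto (fun i => (f i)ᵀ * E * g i) l (𝓝 0) := by
  have hc : Continuous fun p : Matrix (Fin n) (Fin n) ℝ × Matrix (Fin n) (Fin n) ℝ =>
      p.1ᵀ * E * p.2 := by fun_prop
  have h := (hc.tendsto (0, 0)).comp (hf.prodMk_nhds hg)
  rwa [Matrix.mul_zero] at h

/-- The Sylvester equation with stable coefficients has only the trivial homogeneous solution. -/
theorem eq_zero_of_sylvester {F₁ F₂ E : Matrix (Fin n) (Fin n) ℝ} (h₁ : IsStable F₁)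
    (h₂ : IsStable F₂) (h : F₁ᵀ * E + E * F₂ = 0) : E = 0 := by
  -- This product equals `E` at time zero, is constant by the equation, and decays by stability.
  have hderiv : ∀ t : ℝ, 0 ≤ t → HasMatrixDeriv
      (fun τ => (NormedSpace.exp (τ • F₁))ᵀ * E * NormedSpace.exp (τ • F₂)) 0 t := fun t _ => by
    refine (((HasMatrixDeriv.exp_smul F₁ t).transpose.mul_const E).mul
      (HasMatrixDeriv.exp_smul F₂ t)).congr_deriv ?_
    rw [Matrix.transpose_mul]
    calc _ = (NormedSpace.exp (t • F₁))ᵀ * (F₁ᵀ * E + E * F₂) * NormedSpace.exp (t • F₂) := by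
          noncomm_ring
      _ = 0 := by simp [h]
  have hlim := tendsto_transpose_mul_mul h₁.tendsto_exp h₂.tendsto_exp E
  have hconst : Tendsto (fun _ : ℝ => E) atTop (𝓝 0) := by
    refine hlim.congr' ?_
    filter_upwards [eventually_ge_atTop 0] with t ht
    rw [eq_of_hasMatrixDeriv_zero hderiv ht]
    simp
  exact tendsto_nhds_unique tendsto_const_nhds hconst

/-- Solvability of the Lyapunov equation. -/
theorem exists_posSemidef_lyapunov {F M : Matrix (Fin n) (Fin n) ℝ} (hF : IsStable F)
    (hM : M.PosSemidef) : ∃ S : Matrix (Fin n) (Fin n) ℝ, S.PosSemidef ∧ Fᵀ * S + S * F + M = 0 := by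
  rw [posSemidef_iff_quad] at hM
  -- The Lyapunov operator is injective on a finite-dimensional space, hence surjective.
  let L : Matrix (Fin n) (Fin n) ℝ →ₗ[ℝ] Matrix (Fin n) (Fin n) ℝ :=
    LinearMap.mulLeft ℝ Fᵀ + LinearMap.mulRight ℝ F
  have hinj : Function.Injective L :=
    (injective_iff_map_eq_zero L).2 fun E hE => eq_zero_of_sylvester hF hF hE
  obtain ⟨S, hS⟩ := LinearMap.injective_iff_surjective.1 hinj (-M)
  replace hS : Fᵀ * S + S * F = -M := hS
  refine ⟨S, posSemidef_iff_quad.2 ⟨?_, fun x => ?_⟩, by rw [hS, neg_add_cancel]⟩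
  · rw [← sub_eq_zero]
    refine eq_zero_of_sylvester hF hF ?_
    have hS' := congrArg Matrix.transpose hS
    simp only [Matrix.transpose_add, Matrix.transpose_mul, Matrix.transpose_transpose,
      Matrix.transpose_neg, hM.1] at hS'
    calc Fᵀ * (Sᵀ - S) + (Sᵀ - S) * F = (Sᵀ * F + Fᵀ * Sᵀ) - (Fᵀ * S + S * F) := by noncomm_ring
      _ = 0 := by rw [hS', hS, sub_self]
  -- The negated congruence of `S` has nonnegative derivative, so its quadratic form climbs from
  -- that of `-S` to the limit zero.
  · have hderiv : ∀ t : ℝ, 0 ≤ t → HasMatrixDeriv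
        (fun τ => -((NormedSpace.exp (τ • F))ᵀ * S * NormedSpace.exp (τ • F)))
        ((NormedSpace.exp (t • F))ᵀ * M * NormedSpace.exp (t • F)) t := fun t _ => by
      refine (((HasMatrixDeriv.exp_smul F t).transpose.mul_const S).mul
        (HasMatrixDeriv.exp_smul F t)).neg.congr_deriv ?_
      have hM' : M = -(Fᵀ * S + S * F) := by rw [hS, neg_neg]
      rw [Matrix.transpose_mul, hM']
      noncomm_ring
    have hlim : Tendsto (fun τ : ℝ =>
        quad (-((NormedSpace.exp (τ • F))ᵀ * S * NormedSpace.exp (τ • F))) x) atTop (𝓝 0) := by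
      have h := (continuous_quad x).tendsto (-0)
      have h' := h.comp (tendsto_transpose_mul_mul hF.tendsto_exp hF.tendsto_exp S).neg
      have h0 : quad (-0 : Matrix (Fin n) (Fin n) ℝ) x = 0 := by simp [quad]
      rwa [h0] at h'
    have hle : ∀ᶠ t : ℝ in atTop, -quad S x ≤
        quad (-((NormedSpace.exp (t • F))ᵀ * S * NormedSpace.exp (t • F))) x := by
      filter_upwards [eventually_ge_atTop 0] with t ht
      have h := quad_le_quad_of_deriv_nonneg hderiv
        (x := x) (fun τ _ => by rw [quad_conj]; exact hM.2 _) ht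
      simpa [quad_neg] using h
    linarith [ge_of_tendsto hlim hle]

/-- Complex eigenvalues of a real matrix in real terms. -/
theorem mem_spectrum_map_iff {F : Matrix (Fin n) (Fin n) ℝ} {μ : ℂ} :
    μ ∈ spectrum ℂ (F.map (algebraMap ℝ ℂ)) ↔ ∃ a b : Fin n → ℝ, (a ≠ 0 ∨ b ≠ 0) ∧
      F *ᵥ a = μ.re • a - μ.im • b ∧ F *ᵥ b = μ.im • a + μ.re • b := by
  rw [← Matrix.spectrum_toLin', ← Module.End.hasEigenvalue_iff_mem_spectrum]
  constructor
  · intro h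
    obtain ⟨v, hv⟩ := h.exists_hasEigenvector
    have hFv : F.map (algebraMap ℝ ℂ) *ᵥ v = μ • v := by simpa using hv.apply_eq_smul
    refine ⟨fun i => (v i).re, fun i => (v i).im, ?_, ?_, ?_⟩
    · by_contra! h0
      refine hv.2 (funext fun i => Complex.ext ?_ ?_)
      · exact congrFun h0.1 i
      · exact congrFun h0.2 i
    · funext i
      have := congrArg Complex.re (congrFun hFv i)
      simpa [Matrix.mulVec, dotProduct] using this
    · funext i
      have := congrArg Complex.im (congrFun hFv i)
      simp [Matrix.mulVec, dotProduct] at this ⊢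
      linarith
  · rintro ⟨a, b, h0, ha, hb⟩
    refine Module.End.hasEigenvalue_of_hasEigenvector (x := fun i => (⟨a i, b i⟩ : ℂ)) ⟨?_, ?_⟩
    · rw [Module.End.mem_eigenspace_iff]
      funext i
      have ha := congrFun ha i
      have hb := congrFun hb i
      simp [Matrix.mulVec, dotProduct] at ha hb
      refine Complex.ext ?_ ?_
      · simpa [Matrix.mulVec, dotProduct] using ha
      · simp [Matrix.mulVec, dotProduct]
        linarith
    · intro hz
      rcases h0 with h0 | h0
      · exact h0 (funext fun i => congrArg Complex.re (congrFun hz i))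
      · exact h0 (funext fun i => congrArg Complex.im (congrFun hz i))

theorem IsStable.transpose {F : Matrix (Fin n) (Fin n) ℝ} (hF : IsStable F) : IsStable Fᵀ := by
  intro μ hμ
  refine hF μ ?_
  change μ ∈ spectrum ℂ (F.map (algebraMap ℝ ℂ))ᵀ at hμ
  rwa [Matrix.mem_spectrum_iff_isRoot_charpoly, Matrix.charpoly_transpose,
    ← Matrix.mem_spectrum_iff_isRoot_charpoly] at hμ

theorem IsDetectable.exists_stable {p : ℕ} {C : Matrix (Fin p) (Fin n) ℝ}
    {A : Matrix (Fin n) (Fin n) ℝ} (h : IsDetectable C A) :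
    ∃ K : Matrix (Fin p) (Fin n) ℝ, IsStable (A - Kᵀ * C) := by
  obtain ⟨K, hK⟩ := h
  exact ⟨K, by simpa [Matrix.transpose_mul] using hK.transpose⟩

theorem quad_transpose_mul_self_eq_zero {p : ℕ} {C : Matrix (Fin p) (Fin n) ℝ} {x : Fin n → ℝ} :
    quad (Cᵀ * C) x = 0 ↔ C *ᵥ x = 0 := by
  rw [quad_transpose_mul_self, dotProduct_self_eq_zero]

theorem quad_lyapunov {F X : Matrix (Fin n) (Fin n) ℝ} (hX : Xᵀ = X) (x : Fin n → ℝ) :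
    quad (Fᵀ * X + X * F) x = 2 * (x ⬝ᵥ X *ᵥ (F *ᵥ x)) := by
  have h : x ⬝ᵥ (Fᵀ * X) *ᵥ x = x ⬝ᵥ (X * F) *ᵥ x := by
    conv_lhs => rw [Matrix.dotProduct_mulVec, ← Matrix.mulVec_transpose, dotProduct_comm,
      Matrix.transpose_mul, Matrix.transpose_transpose, hX]
  rw [quad_add, quad, quad, h, ← Matrix.mulVec_mulVec]
  ring

/-- Under detectability every nonnegative definite solution of the algebraic equation is
stabilizing. -/
theorem IsDetectable.isStabilizing {s p : ℕ} {A : Matrix (Fin n) (Fin n) ℝ}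
    {B : Matrix (Fin n) (Fin s) ℝ} {C : Matrix (Fin p) (Fin n) ℝ} (hdet : IsDetectable C A)
    {X : Matrix (Fin n) (Fin n) ℝ} (hX : X.PosSemidef) (h : IsAlgebraicSolution A B C X) :
    IsStabilizing A B X := by
  obtain ⟨hsymm, hnonneg⟩ := posSemidef_iff_quad.1 hX
  obtain ⟨K, hK⟩ := hdet.exists_stable
  intro μ hμ
  by_contra! hre
  obtain ⟨a, b, h0, ha, hb⟩ := mem_spectrum_map_iff.1 hμ
  set F := A - B * Bᵀ * X with hF
  -- The Riccati equation rewritten as a Lyapunov equation for the closed loop.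
  have hlyap : Fᵀ * X + X * F + ((Bᵀ * X)ᵀ * (Bᵀ * X) + Cᵀ * C) = 0 := by
    rw [← h, riccati, hF]
    simp only [Matrix.transpose_sub, Matrix.transpose_mul, Matrix.transpose_transpose, hsymm,
      sub_mul, mul_sub, Matrix.mul_assoc]
    abel
  have key : ∀ x, 2 * (x ⬝ᵥ X *ᵥ (F *ᵥ x)) + (quad ((Bᵀ * X)ᵀ * (Bᵀ * X)) x
      + quad (Cᵀ * C) x) = 0 := fun x => by
    rw [← quad_lyapunov hsymm, ← quad_add, ← quad_add, hlyap]
    simp [quad]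
  have hab : a ⬝ᵥ X *ᵥ b = b ⬝ᵥ X *ᵥ a := by
    conv_lhs => rw [Matrix.dotProduct_mulVec, ← Matrix.mulVec_transpose, dotProduct_comm, hsymm]
  -- In `ka + kb` the terms with `μ.im` cancel. With `0 ≤ μ.re` every remaining term is nonnegative,
  -- so each vanishes.
  have ka := key a
  have kb := key b
  rw [ha, Matrix.mulVec_sub, Matrix.mulVec_smul, Matrix.mulVec_smul, dotProduct_sub,
    dotProduct_smul, dotProduct_smul, smul_eq_mul, smul_eq_mul, hab] at ka
  rw [hb, Matrix.mulVec_add, Matrix.mulVec_smul, Matrix.mulVec_smul, dotProduct_add,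
    dotProduct_smul, dotProduct_smul, smul_eq_mul, smul_eq_mul] at kb
  have p1 := mul_nonneg hre (hnonneg a)
  have p2 := mul_nonneg hre (hnonneg b)
  rw [quad] at p1 p2
  have q1 := quad_transpose_mul_self_nonneg (Bᵀ * X) a
  have q2 := quad_transpose_mul_self_nonneg (Bᵀ * X) b
  have q3 := quad_transpose_mul_self_nonneg C a
  have q4 := quad_transpose_mul_self_nonneg C b
  have z1 := quad_transpose_mul_self_eq_zero.1
    (show quad ((Bᵀ * X)ᵀ * (Bᵀ * X)) a = 0 by linarith)
  have z2 := quad_transpose_mul_self_eq_zero.1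
    (show quad ((Bᵀ * X)ᵀ * (Bᵀ * X)) b = 0 by linarith)
  have z3 := quad_transpose_mul_self_eq_zero.1 (show quad (Cᵀ * C) a = 0 by linarith)
  have z4 := quad_transpose_mul_self_eq_zero.1 (show quad (Cᵀ * C) b = 0 by linarith)
  -- On vectors killed by `Bᵀ X` and `C` the closed loop agrees with the stable `A - Kᵀ C`, which
  -- would thus inherit the eigenvalue `μ`.
  have transfer : ∀ x, (Bᵀ * X) *ᵥ x = 0 → C *ᵥ x = 0 → (A - Kᵀ * C) *ᵥ x = F *ᵥ x := by
    intro x h1 h2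
    rw [hF, Matrix.sub_mulVec, Matrix.sub_mulVec, Matrix.mul_assoc, ← Matrix.mulVec_mulVec x Kᵀ,
      ← Matrix.mulVec_mulVec x B, h1, h2, Matrix.mulVec_zero, Matrix.mulVec_zero]
  refine absurd (hK μ (mem_spectrum_map_iff.2 ⟨a, b, h0, ?_, ?_⟩)) (not_lt.2 hre)
  · rw [transfer a z1 z3, ha]
  · rw [transfer b z2 z4, hb]

/-- Subtracting the equations gives a homogeneous Sylvester equation for `X₁ - X₂` whose
coefficients are the two closed-loop matrices. -/
theorem IsAlgebraicSolution.eq_of_isStabilizing {s p : ℕ} {A : Matrix (Fin n) (Fin n) ℝ}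
    {B : Matrix (Fin n) (Fin s) ℝ} {C : Matrix (Fin p) (Fin n) ℝ}
    {X₁ X₂ : Matrix (Fin n) (Fin n) ℝ} (hsymm : X₁ᵀ = X₁)
    (h₁ : IsAlgebraicSolution A B C X₁) (h₂ : IsAlgebraicSolution A B C X₂)
    (hs₁ : IsStabilizing A B X₁) (hs₂ : IsStabilizing A B X₂) : X₁ = X₂ := by
  rw [← sub_eq_zero]
  refine eq_zero_of_sylvester hs₁ hs₂ ?_
  calc (A - B * Bᵀ * X₁)ᵀ * (X₁ - X₂) + (X₁ - X₂) * (A - B * Bᵀ * X₂)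
      = riccati A B C X₁ - riccati A B C X₂ := by
        simp only [riccati, Matrix.transpose_sub, Matrix.transpose_mul, Matrix.transpose_transpose,
          hsymm, sub_mul, mul_sub, Matrix.mul_assoc]
        abel
    _ = 0 := by rw [h₁, h₂, sub_zero]

end Riccati

/-! ### Hamiltonian flow; global existence and uniqueness. -/

namespace Riccati

open Filter Topology

variable {n s p : ℕ}

/-- The linear system behind the Riccati equation, solved by one exponential of the block
Hamiltonian matrix. -/
theorem exists_hamiltonian_flow (A G Q X₀ : Matrix (Fin n) (Fin n) ℝ) :
    ∃ U W : ℝ → Matrix (Fin n) (Fin n) ℝ, U 0 = 1 ∧ W 0 = X₀ ∧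
      ∀ t, HasMatrixDeriv U (-(A * U t) + G * W t) t ∧
        HasMatrixDeriv W (Q * U t + Aᵀ * W t) t := by
  set H := Matrix.fromBlocks (-A) G Q Aᵀ with hH
  set Φ : ℝ → Matrix (Fin n ⊕ Fin n) (Fin n) ℝ := fun t =>
    (NormedSpace.exp (t • H) : Matrix (Fin n ⊕ Fin n) (Fin n ⊕ Fin n) ℝ) *
      (Matrix.fromRows 1 X₀ : Matrix (Fin n ⊕ Fin n) (Fin n) ℝ) with hΦ
  have hderiv : ∀ t, HasMatrixDeriv Φ (Matrix.fromRows (-(A * (Φ t).toRows₁) + G * (Φ t).toRows₂)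
      (Q * (Φ t).toRows₁ + Aᵀ * (Φ t).toRows₂)) t := fun t => by
    refine ((HasMatrixDeriv.exp_smul H t).mul_const (Matrix.fromRows 1 X₀)).congr_deriv ?_
    have h : Φ t = Matrix.fromRows (Φ t).toRows₁ (Φ t).toRows₂ := (Matrix.fromRows_toRows _).symm
    rw [Matrix.mul_assoc]
    change H * Φ t = _
    conv_lhs => rw [h, hH, Matrix.fromBlocks_mul_fromRows, Matrix.neg_mul]
  refine ⟨fun t => (Φ t).toRows₁, fun t => (Φ t).toRows₂, ?_, ?_, fun t => ⟨?_, ?_⟩⟩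
  · simp only [hΦ, zero_smul, NormedSpace.exp_zero]
    rw [Matrix.one_mul, Matrix.toRows₁_fromRows]
  · simp only [hΦ, zero_smul, NormedSpace.exp_zero]
    rw [Matrix.one_mul, Matrix.toRows₂_fromRows]
  · exact fun i j => hderiv t (Sum.inl i) j
  · exact fun i j => hderiv t (Sum.inr i) j

theorem hasDerivWithinAt_mulVec {M : ℝ → Matrix (Fin n) (Fin n) ℝ} {M' : Matrix (Fin n) (Fin n) ℝ}
    {t : ℝ} (hM : HasMatrixDeriv M M' t) (v : Fin n → ℝ) (i : Fin n) :
    HasDerivWithinAt (fun τ => (M τ *ᵥ v) i) ((M' *ᵥ v) i) (Set.Ici 0) t := by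
  simp only [Matrix.mulVec, dotProduct]
  exact HasDerivWithinAt.fun_sum fun j _ => (hM i j).mul_const (v j)

/-- A nondecreasing function on `[0, ∞)` with equal values at `0` and `t` has vanishing derivative
in between. -/
theorem deriv_eq_zero_of_monotoneOn {f f' : ℝ → ℝ}
    (hf : ∀ τ, 0 ≤ τ → HasDerivWithinAt f (f' τ) (Set.Ici 0) τ) (hmono : MonotoneOn f (Set.Ici 0))
    {t : ℝ} (h : f t ≤ f 0) {τ : ℝ} (hτ : τ ∈ Set.Ico 0 t) : f' τ = 0 := by
  have hconst : ∀ σ ∈ Set.Icc τ t, f σ = f 0 := fun σ hσ => by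
    have h0 : 0 ≤ σ := hτ.1.trans hσ.1
    exact le_antisymm ((hmono h0 (h0.trans hσ.2) hσ.2).trans h) (hmono Set.self_mem_Ici h0 h0)
  have hmem : τ ∈ Set.Icc τ t := ⟨le_rfl, hτ.2.le⟩
  have h1 : HasDerivWithinAt f 0 (Set.Icc τ t) τ :=
    (hasDerivWithinAt_const τ (Set.Icc τ t) (f 0)).congr hconst (hconst τ hmem)
  have h2 : HasDerivWithinAt f (f' τ) (Set.Icc τ t) τ :=
    (hf τ hτ.1).mono fun σ hσ => hτ.1.trans hσ.1
  exact (uniqueDiffOn_Icc hτ.2 τ hmem).eq_deriv _ h2 h1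

section flow

variable {A : Matrix (Fin n) (Fin n) ℝ} {B : Matrix (Fin n) (Fin s) ℝ}
  {C : Matrix (Fin p) (Fin n) ℝ} {U W : ℝ → Matrix (Fin n) (Fin n) ℝ}

/-- The terms with `A` cancel, leaving a sum of Gram matrices; this gives monotonicity and symmetry
of `Uᵀ W`. -/
theorem hasMatrixDeriv_transpose_mul {t : ℝ}
    (hU : HasMatrixDeriv U (-(A * U t) + B * Bᵀ * W t) t)
    (hW : HasMatrixDeriv W (Cᵀ * C * U t + Aᵀ * W t) t) :
    HasMatrixDeriv (fun τ => (U τ)ᵀ * W τ)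
      ((Bᵀ * W t)ᵀ * (Bᵀ * W t) + (C * U t)ᵀ * (C * U t)) t := by
  refine (hU.transpose.mul hW).congr_deriv ?_
  simp only [Matrix.transpose_add, Matrix.transpose_neg, Matrix.transpose_mul,
    Matrix.transpose_transpose, add_mul, mul_add, neg_mul, Matrix.mul_assoc]
  abel

variable (hU : ∀ t, HasMatrixDeriv U (-(A * U t) + B * Bᵀ * W t) t)
  (hW : ∀ t, HasMatrixDeriv W (Cᵀ * C * U t + Aᵀ * W t) t)
include hU hW

theorem monotoneOn_quad_flow (x : Fin n → ℝ) :
    MonotoneOn (fun τ => quad ((U τ)ᵀ * W τ) x) (Set.Ici 0) :=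
  monotoneOn_quad (fun t _ => hasMatrixDeriv_transpose_mul (hU t) (hW t)) fun t _ => by
    rw [quad_add]
    exact add_nonneg (quad_transpose_mul_self_nonneg _ _) (quad_transpose_mul_self_nonneg _ _)

/-- If `U t` kills `v`, the nondecreasing form of `Uᵀ W` at `v` is nonnegative at `0` and zero at
`t`, so its derivative vanishes and `Bᵀ W v = 0` on `[0, t)`. There `U v` follows the uncontrolled
flow `-A`, so `exp(τ A) U v` is constant and `v = 0`. -/
theorem isUnit_flow (hU0 : U 0 = 1) (hW0 : (W 0).PosSemidef) {t : ℝ} (ht : 0 ≤ t) :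
    IsUnit (U t) := by
  rw [← Matrix.mulVec_injective_iff_isUnit, ← Matrix.coe_mulVecLin, ← LinearMap.ker_eq_bot,
    LinearMap.ker_eq_bot']
  intro v hv
  rw [Matrix.mulVecLin_apply] at hv
  have hle : quad ((U t)ᵀ * W t) v ≤ quad ((U 0)ᵀ * W 0) v := by
    rw [hU0, Matrix.transpose_one, Matrix.one_mul, quad, ← Matrix.mulVec_mulVec,
      Matrix.dotProduct_mulVec, Matrix.vecMul_transpose, hv, zero_dotProduct]
    exact (posSemidef_iff_quad.1 hW0).2 v
  have hBW : ∀ τ ∈ Set.Ico 0 t, (Bᵀ * W τ) *ᵥ v = 0 := fun τ hτ => by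
    have h := deriv_eq_zero_of_monotoneOn
      (fun σ _ => hasDerivWithinAt_quad (hasMatrixDeriv_transpose_mul (hU σ) (hW σ)) v)
      (monotoneOn_quad_flow hU hW v) hle hτ
    rw [quad_add] at h
    exact quad_transpose_mul_self_eq_zero.1 (le_antisymm
      (by linarith [quad_transpose_mul_self_nonneg (C * U τ) v])
      (quad_transpose_mul_self_nonneg _ _))
  have hderiv : ∀ τ, HasMatrixDeriv (fun σ => NormedSpace.exp (σ • A) * U σ)
      (NormedSpace.exp (τ • A) * B * (Bᵀ * W τ)) τ := fun τ => by
    refine ((HasMatrixDeriv.exp_smul A τ).mul (hU τ)).congr_deriv ?_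
    rw [exp_smul_mul_comm A]
    simp only [mul_add, mul_neg, Matrix.mul_assoc]
    abel
  have hconst : (NormedSpace.exp (t • A) * U t) *ᵥ v
      = (NormedSpace.exp ((0 : ℝ) • A) * U 0) *ᵥ v := by
    funext i
    refine constant_of_has_deriv_right_zero
      (f := fun τ => ((NormedSpace.exp (τ • A) * U τ) *ᵥ v) i) (a := 0) (b := t)
      (fun τ hτ => ((hasDerivWithinAt_mulVec (hderiv τ) v i).mono
        Set.Icc_subset_Ici_self).continuousWithinAt) (fun τ hτ => ?_) t ⟨ht, le_rfl⟩
    have h := hasDerivWithinAt_mulVec (hderiv τ) v i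
    rw [← Matrix.mulVec_mulVec, hBW τ hτ, Matrix.mulVec_zero] at h
    exact h.mono (Set.Ici_subset_Ici.2 hτ.1)
  rw [← Matrix.mulVec_mulVec, hv, Matrix.mulVec_zero, hU0] at hconst
  simpa using hconst.symm

theorem transpose_mul_flow_symm (hU0 : U 0 = 1) (hW0 : (W 0)ᵀ = W 0) {t : ℝ} (ht : 0 ≤ t) :
    ((U t)ᵀ * W t)ᵀ = (U t)ᵀ * W t := by
  have h := eq_of_hasMatrixDeriv_zero (M := fun τ => ((U τ)ᵀ * W τ)ᵀ - (U τ)ᵀ * W τ)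
    (fun τ _ => by
      have h := hasMatrixDeriv_transpose_mul (hU τ) (hW τ)
      refine (h.transpose.sub h).congr_deriv ?_
      simp [Matrix.transpose_mul]) ht
  simpa [hU0, hW0, sub_eq_zero] using h

end flow

/-- Global solvability of the differential Riccati equation for nonnegative definite initial
values, together with the fundamental matrix of the closed-loop system run backwards. -/
theorem exists_solution (A : Matrix (Fin n) (Fin n) ℝ) (B : Matrix (Fin n) (Fin s) ℝ)
    (C : Matrix (Fin p) (Fin n) ℝ) {X₀ : Matrix (Fin n) (Fin n) ℝ} (hX₀ : X₀.PosSemidef) :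
    ∃ X U : ℝ → Matrix (Fin n) (Fin n) ℝ, X 0 = X₀ ∧ ∀ t, 0 ≤ t →
      HasMatrixDeriv X (riccati A B C (X t)) t ∧ (X t).PosSemidef ∧ IsUnit (U t) ∧
      HasMatrixDeriv U (-((A - B * Bᵀ * X t) * U t)) t ∧ U 0 = 1 := by
  obtain ⟨U, W, hU0, hW0, hUW⟩ := exists_hamiltonian_flow A (B * Bᵀ) (Cᵀ * C) X₀
  have hU := fun t => (hUW t).1
  have hW := fun t => (hUW t).2
  rw [← hW0] at hX₀ ⊢
  refine ⟨fun t => W t * (U t)⁻¹, U, by simp [hU0], fun t ht => ?_⟩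
  have hunit := isUnit_flow hU hW hU0 hX₀ ht
  have hdet := (Matrix.isUnit_iff_isUnit_det _).1 hunit
  refine ⟨?_, ?_, hunit, ?_, hU0⟩
  · refine ((hW t).mul ((hU t).inv hunit)).congr_deriv ?_
    have e1 : Cᵀ * C * U t * (U t)⁻¹ = Cᵀ * C := Matrix.mul_nonsing_inv_cancel_right _ _ hdet
    have e2 : A * U t * (U t)⁻¹ = A := Matrix.mul_nonsing_inv_cancel_right _ _ hdet
    have e3 : (U t)⁻¹ * (-(A * U t) + B * Bᵀ * W t) * (U t)⁻¹
        = (U t)⁻¹ * (B * Bᵀ * (W t * (U t)⁻¹) - A) := by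
      conv_rhs => rw [← e2]
      noncomm_ring
    rw [e3, add_mul, e1]
    simp only [riccati, mul_sub, mul_neg, Matrix.mul_assoc]
    abel
  · have hS := transpose_mul_flow_symm hU hW hU0 (posSemidef_iff_quad.1 hX₀).1 ht
    -- A congruence of `Uᵀ W`, which is symmetric and dominates `W 0`.
    have hX : W t * (U t)⁻¹ = ((U t)⁻¹)ᵀ * ((U t)ᵀ * W t) * (U t)⁻¹ := by
      rw [← Matrix.mul_assoc ((U t)⁻¹)ᵀ, ← Matrix.transpose_mul, Matrix.mul_nonsing_inv _ hdet,
        Matrix.transpose_one, Matrix.one_mul]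
    refine posSemidef_iff_quad.2 ⟨?_, fun x => ?_⟩
    · beta_reduce
      rw [hX, Matrix.transpose_mul, Matrix.transpose_mul, hS, Matrix.transpose_transpose,
        ← Matrix.mul_assoc]
    · beta_reduce
      rw [hX, quad_conj]
      refine le_trans ?_ (monotoneOn_quad_flow hU hW _ Set.self_mem_Ici ht ht)
      simp only [hU0, Matrix.transpose_one, Matrix.one_mul]
      exact (posSemidef_iff_quad.1 hX₀).2 _
  · refine (hU t).congr_deriv ?_
    rw [sub_mul, Matrix.mul_assoc _ (W t * (U t)⁻¹), Matrix.nonsing_inv_mul_cancel_right _ _ hdet,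
      neg_sub, neg_add_eq_sub]

open scoped Matrix.Norms.Operator in
/-- Uniqueness for the differential Riccati equation. -/
theorem solution_unique {A : Matrix (Fin n) (Fin n) ℝ} {B : Matrix (Fin n) (Fin s) ℝ}
    {C : Matrix (Fin p) (Fin n) ℝ} {X Y : ℝ → Matrix (Fin n) (Fin n) ℝ} (h0 : Y 0 = X 0)
    (hX : ∀ t, 0 ≤ t → HasMatrixDeriv X (riccati A B C (X t)) t)
    (hY : ∀ t, 0 ≤ t → HasMatrixDeriv Y (riccati A B C (Y t)) t) {t : ℝ} (ht : 0 ≤ t) :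
    Y t = X t := by
  have hXc : ContinuousOn (fun τ => A - B * Bᵀ * X τ) (Set.Icc 0 t) :=
    continuousOn_const.sub (continuousOn_const.mul fun τ hτ =>
      (hX τ hτ.1).continuousWithinAt.mono Set.Icc_subset_Ici_self)
  have hYc : ContinuousOn (fun τ => Aᵀ - Y τ * (B * Bᵀ)) (Set.Icc 0 t) :=
    continuousOn_const.sub (ContinuousOn.mul (fun τ hτ =>
      (hY τ hτ.1).continuousWithinAt.mono Set.Icc_subset_Ici_self) continuousOn_const)
  obtain ⟨c₁, hc₁⟩ := isCompact_Icc.exists_bound_of_continuousOn hXc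
  obtain ⟨c₂, hc₂⟩ := isCompact_Icc.exists_bound_of_continuousOn hYc
  -- The difference solves a linear equation with coefficients bounded on `[0, t]`, so Grönwall
  -- applies.
  have hd : ∀ τ, 0 ≤ τ → HasMatrixDeriv (fun σ => Y σ - X σ)
      ((Aᵀ - Y τ * (B * Bᵀ)) * (Y τ - X τ) + (Y τ - X τ) * (A - B * Bᵀ * X τ)) τ := fun τ hτ => by
    refine ((hY τ hτ).sub (hX τ hτ)).congr_deriv ?_
    simp only [riccati, sub_mul, mul_sub, Matrix.mul_assoc]
    abel
  have hd' := fun τ hτ => HasMatrixDeriv.iff_hasDerivWithinAt.1 (hd τ hτ)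
  have key := eq_zero_of_abs_deriv_le_mul_abs_self_of_eq_zero_right (K := c₂ + c₁)
    (f := fun σ => Y σ - X σ) (a := 0) (b := t)
    (fun τ hτ => (hd' τ hτ.1).continuousWithinAt.mono Set.Icc_subset_Ici_self)
    (fun τ hτ => (hd' τ hτ.1).mono (Set.Ici_subset_Ici.2 hτ.1)) (by simp [h0])
    (fun τ hτ => by
      have hτ' : τ ∈ Set.Icc 0 t := ⟨hτ.1, hτ.2.le⟩
      refine (norm_add_le _ _).trans ?_
      rw [add_mul]
      refine add_le_add ((norm_mul_le _ _).trans ?_) ((norm_mul_le _ _).trans ?_)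
      · exact mul_le_mul_of_nonneg_right (hc₂ τ hτ') (norm_nonneg _)
      · rw [mul_comm]
        exact mul_le_mul_of_nonneg_right (hc₁ τ hτ') (norm_nonneg _)) t ⟨ht, le_rfl⟩
  exact sub_eq_zero.1 key

end Riccati

/-! ### Comparison of solutions and convergence. -/

namespace Riccati

open Filter Topology

variable {n s p : ℕ}

/-- Congruence with the backward fundamental matrix turns a solution of a Lyapunov differential
inequality into a nondecreasing function. -/
theorem quad_comparison {E F N U : ℝ → Matrix (Fin n) (Fin n) ℝ}
    (hU : ∀ t, 0 ≤ t → HasMatrixDeriv U (-(F t * U t)) t)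
    (hE : ∀ t, 0 ≤ t → HasMatrixDeriv E ((F t)ᵀ * E t + E t * F t + N t) t)
    (hN : ∀ t, 0 ≤ t → ∀ x, 0 ≤ quad (N t) x) (x : Fin n → ℝ) {t : ℝ} (ht : 0 ≤ t) :
    quad (E 0) (U 0 *ᵥ x) ≤ quad (E t) (U t *ᵥ x) := by
  rw [← quad_conj, ← quad_conj]
  refine quad_le_quad_of_deriv_nonneg (M := fun τ => (U τ)ᵀ * E τ * U τ)
    (M' := fun τ => (U τ)ᵀ * N τ * U τ) (fun τ hτ => ?_) (fun τ hτ => ?_) ht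
  · refine (((hU τ hτ).transpose.mul (hE τ hτ)).mul (hU τ hτ)).congr_deriv ?_
    rw [Matrix.transpose_neg, Matrix.transpose_mul]
    simp only [add_mul, mul_add, neg_mul, mul_neg, mul_assoc]
    abel
  · rw [quad_conj]
    exact hN τ hτ _

theorem quad_nonneg_of_comparison {E F N U : ℝ → Matrix (Fin n) (Fin n) ℝ}
    (hU : ∀ t, 0 ≤ t → HasMatrixDeriv U (-(F t * U t)) t)
    (hE : ∀ t, 0 ≤ t → HasMatrixDeriv E ((F t)ᵀ * E t + E t * F t + N t) t)
    (hN : ∀ t, 0 ≤ t → ∀ x, 0 ≤ quad (N t) x) (h0 : ∀ x, 0 ≤ quad (E 0) x) {t : ℝ} (ht : 0 ≤ t)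
    (hunit : IsUnit (U t)) (x : Fin n → ℝ) : 0 ≤ quad (E t) x := by
  have h := quad_comparison hU hE hN ((U t)⁻¹ *ᵥ x) ht
  rw [Matrix.mulVec_mulVec, Matrix.mulVec_mulVec x (U t),
    Matrix.mul_nonsing_inv _ ((Matrix.isUnit_iff_isUnit_det _).1 hunit), Matrix.one_mulVec] at h
  rw [← Matrix.mulVec_mulVec] at h
  exact (h0 _).trans h

theorem hasMatrixDeriv_exp_neg (F : Matrix (Fin n) (Fin n) ℝ) (t : ℝ) :
    HasMatrixDeriv (fun τ => NormedSpace.exp (τ • (-F))) (-(F * NormedSpace.exp (t • (-F)))) t := by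
  simpa using HasMatrixDeriv.exp_smul (-F) t

variable {A : Matrix (Fin n) (Fin n) ℝ} {B : Matrix (Fin n) (Fin s) ℝ}
  {C : Matrix (Fin p) (Fin n) ℝ}

/-- Completing the square: relative to the closed loop of `X`, the quadratic remainder has a
favourable sign. -/
theorem riccati_sub_riccati {X Y : Matrix (Fin n) (Fin n) ℝ} (hX : Xᵀ = X) (hY : Yᵀ = Y) :
    riccati A B C X - riccati A B C Y = (A - B * Bᵀ * X)ᵀ * (X - Y) + (X - Y) * (A - B * Bᵀ * X)
      + (Bᵀ * (X - Y))ᵀ * (Bᵀ * (X - Y)) := by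
  simp only [riccati, Matrix.transpose_sub, Matrix.transpose_mul, Matrix.transpose_transpose,
    hX, hY, sub_mul, mul_sub, Matrix.mul_sub, Matrix.sub_mul, Matrix.mul_assoc]
  abel

/-- Completing the square in the feedback: `S` represents the cost of the fixed gain `K`, and the
remainder measures its distance from `Bᵀ P`. -/
theorem lyapunov_sub_riccati {S P : Matrix (Fin n) (Fin n) ℝ} {K : Matrix (Fin s) (Fin n) ℝ}
    (hP : Pᵀ = P)
    (hS : (A - B * K)ᵀ * S + S * (A - B * K) + (Cᵀ * C + Kᵀ * K) = 0) :
    0 - riccati A B C P = (A - B * K)ᵀ * (S - P) + (S - P) * (A - B * K)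
      + (K - Bᵀ * P)ᵀ * (K - Bᵀ * P) := by
  rw [← hS]
  simp only [riccati, Matrix.transpose_sub, Matrix.transpose_mul, Matrix.transpose_transpose,
    hP, sub_mul, mul_sub, Matrix.mul_sub, Matrix.sub_mul, Matrix.mul_assoc]
  abel

/-- The residual satisfies the linearized equation, so its sign persists. The trailing `0` is the
source term expected by `quad_comparison`. -/
theorem hasMatrixDeriv_riccati {P : ℝ → Matrix (Fin n) (Fin n) ℝ} {t : ℝ}
    (hP : HasMatrixDeriv P (riccati A B C (P t)) t) (hsymm : (P t)ᵀ = P t) :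
    HasMatrixDeriv (fun τ => riccati A B C (P τ))
      ((A - B * Bᵀ * P t)ᵀ * riccati A B C (P t) + riccati A B C (P t) * (A - B * Bᵀ * P t) + 0)
      t := by
  refine ((((hP.const_mul Aᵀ).add (hP.mul_const A)).sub
    (((hP.mul_const B).mul_const Bᵀ).mul hP)).add (HasMatrixDeriv.const (Cᵀ * C) t)).congr_deriv ?_
  rw [Matrix.transpose_sub, Matrix.transpose_mul, Matrix.transpose_mul, Matrix.transpose_transpose,
    hsymm]
  generalize riccati A B C (P t) = R
  simp only [sub_mul, mul_sub, Matrix.mul_assoc]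
  abel

/-- If a function and its derivative both converge at infinity, the derivative tends to zero. -/
theorem eq_zero_of_tendsto_deriv {f f' : ℝ → ℝ} {l c : ℝ}
    (hf : ∀ t, 0 ≤ t → HasDerivWithinAt f (f' t) (Set.Ici 0) t) (hl : Tendsto f atTop (𝓝 l))
    (hc : Tendsto f' atTop (𝓝 c)) : c = 0 := by
  -- Mean value theorem on `[t, t + 1]`; negative times get a dummy point so that `ξ` is a total
  -- function.
  have h : ∀ t : ℝ, ∃ ξ, t ≤ ξ ∧ (0 ≤ t → f' ξ = f (t + 1) - f t) := fun t => by
    by_cases ht : 0 ≤ t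
    · obtain ⟨ξ, hξ, h⟩ := exists_hasDerivAt_eq_slope f f' (lt_add_one t)
        (fun τ hτ => ((hf τ (ht.trans hτ.1)).continuousWithinAt).mono
          fun σ hσ => ht.trans hσ.1)
        (fun τ hτ => (hf τ (ht.trans hτ.1.le)).hasDerivAt (Ici_mem_nhds (ht.trans_lt hτ.1)))
      exact ⟨ξ, hξ.1.le, fun _ => by simpa using h⟩
    · exact ⟨t, le_rfl, fun h => absurd h ht⟩
  choose ξ hξ h using h
  have h1 : Tendsto (fun t => f' (ξ t)) atTop (𝓝 c) := hc.comp (tendsto_atTop_mono hξ tendsto_id)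
  have h2 : Tendsto (fun t => f (t + 1) - f t) atTop (𝓝 (l - l)) :=
    (hl.comp (tendsto_atTop_add_const_right _ _ tendsto_id)).sub hl
  rw [sub_self] at h2
  refine tendsto_nhds_unique (h1.congr' ?_) h2
  filter_upwards [eventually_ge_atTop 0] with t ht using h t ht

theorem exists_tendsto_of_monotoneOn {f : ℝ → ℝ} {b : ℝ} (hf : MonotoneOn f (Set.Ici 0))
    (hb : ∀ t, 0 ≤ t → f t ≤ b) : ∃ l, Tendsto f atTop (𝓝 l) := by
  have hmono : Monotone fun t => f (max t 0) := fun x y hxy =>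
    hf (Set.mem_Ici.2 (le_max_right x 0)) (Set.mem_Ici.2 (le_max_right y 0))
      (max_le_max_right 0 hxy)
  refine ⟨_, (tendsto_atTop_ciSup hmono ⟨b, ?_⟩).congr' ?_⟩
  · rintro _ ⟨t, rfl⟩
    exact hb _ (le_max_right _ _)
  · filter_upwards [eventually_ge_atTop 0] with t ht
    rw [max_eq_left ht]

/-- The solution started at zero converges to a nonnegative definite solution of the algebraic
equation. -/
theorem IsStabilizable.exists_tendsto (hstab : IsStabilizable A B)
    {P U : ℝ → Matrix (Fin n) (Fin n) ℝ} (hP0 : P 0 = 0)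
    (hP : ∀ t, 0 ≤ t → HasMatrixDeriv P (riccati A B C (P t)) t ∧ (P t).PosSemidef ∧
      IsUnit (U t) ∧ HasMatrixDeriv U (-((A - B * Bᵀ * P t) * U t)) t ∧ U 0 = 1) :
    ∃ L : Matrix (Fin n) (Fin n) ℝ, L.PosSemidef ∧ IsAlgebraicSolution A B C L ∧
      Tendsto P atTop (𝓝 L) := by
  obtain ⟨K, hK⟩ := hstab
  have hsymm : ∀ t, 0 ≤ t → (P t)ᵀ = P t := fun t ht => (posSemidef_iff_quad.1 (hP t ht).2.1).1
  have hderiv : ∀ t, 0 ≤ t → HasMatrixDeriv P (riccati A B C (P t)) t := fun t ht => (hP t ht).1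
  have hR0 : ∀ x, 0 ≤ quad (riccati A B C (P 0)) x := fun x => by
    simpa [hP0, riccati] using quad_transpose_mul_self_nonneg C x
  have hR : ∀ t, 0 ≤ t → ∀ x, 0 ≤ quad (riccati A B C (P t)) x := fun t ht x =>
    quad_nonneg_of_comparison (N := fun _ => 0) (fun τ hτ => (hP τ hτ).2.2.2.1)
      (fun τ hτ => hasMatrixDeriv_riccati (hderiv τ hτ) (hsymm τ hτ))
      (fun _ _ x => by simp [quad]) hR0 ht (hP t ht).2.2.1 x
  have hM : (Cᵀ * C + Kᵀ * K).PosSemidef :=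
    posSemidef_iff_quad.2 ⟨by simp [Matrix.transpose_mul], fun x => by
      rw [quad_add]
      exact add_nonneg (quad_transpose_mul_self_nonneg _ _) (quad_transpose_mul_self_nonneg _ _)⟩
  obtain ⟨S, hS, hSeq⟩ := exists_posSemidef_lyapunov hK hM
  have hbound : ∀ t, 0 ≤ t → ∀ x, quad (P t) x ≤ quad S x := fun t ht x => by
    have h := quad_nonneg_of_comparison (E := fun τ => S - P τ)
      (fun τ _ => hasMatrixDeriv_exp_neg (A - B * K) τ)
      (fun τ hτ => ((HasMatrixDeriv.const S τ).sub (hderiv τ hτ)).congr_deriv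
        (lyapunov_sub_riccati (hsymm τ hτ) hSeq))
      (fun τ _ x => quad_transpose_mul_self_nonneg _ x)
      (fun x => by simpa [hP0] using (posSemidef_iff_quad.1 hS).2 x) ht (Matrix.isUnit_exp _) x
    rw [quad_sub] at h
    linarith
  obtain ⟨L, hL⟩ := exists_tendsto_of_quad hsymm fun x =>
    exists_tendsto_of_monotoneOn (monotoneOn_quad hderiv fun t ht => hR t ht x)
      fun t ht => hbound t ht x
  refine ⟨L, posSemidef_iff_quad.2 ⟨?_, fun x => ?_⟩, ?_, hL⟩
  · have hc : Continuous fun M : Matrix (Fin n) (Fin n) ℝ => Mᵀ := by fun_prop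
    refine tendsto_nhds_unique ((hc.tendsto L).comp hL) (hL.congr' ?_)
    filter_upwards [eventually_ge_atTop 0] with t ht using (hsymm t ht).symm
  · refine ge_of_tendsto (((continuous_quad x).tendsto L).comp hL) ?_
    filter_upwards [eventually_ge_atTop 0] with t ht
      using (posSemidef_iff_quad.1 (hP t ht).2.1).2 x
  · have hc : Continuous fun M : Matrix (Fin n) (Fin n) ℝ => riccati A B C M := by
      unfold riccati
      fun_prop
    have hlim := (hc.tendsto L).comp hL
    ext i j
    exact eq_zero_of_tendsto_deriv (fun t ht => hderiv t ht i j)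
      (tendsto_pi_nhds.1 (tendsto_pi_nhds.1 hL i) j)
      (tendsto_pi_nhds.1 (tendsto_pi_nhds.1 hlim i) j)

/-- Convergence of every solution with nonnegative definite initial value. -/
theorem tendsto_of_posSemidef {L : Matrix (Fin n) (Fin n) ℝ} (hLpos : L.PosSemidef)
    (hL : IsAlgebraicSolution A B C L) (hstabL : IsStabilizing A B L)
    {P : ℝ → Matrix (Fin n) (Fin n) ℝ} (hP0 : P 0 = 0)
    (hP : ∀ t, 0 ≤ t → HasMatrixDeriv P (riccati A B C (P t)) t ∧ (P t).PosSemidef)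
    (hPL : Tendsto P atTop (𝓝 L)) {X U : ℝ → Matrix (Fin n) (Fin n) ℝ}
    (hX : ∀ t, 0 ≤ t → HasMatrixDeriv X (riccati A B C (X t)) t ∧ (X t).PosSemidef ∧
      IsUnit (U t) ∧ HasMatrixDeriv U (-((A - B * Bᵀ * X t) * U t)) t ∧ U 0 = 1) :
    Tendsto X atTop (𝓝 L) := by
  have hLsymm := (posSemidef_iff_quad.1 hLpos).1
  have hPsymm : ∀ t, 0 ≤ t → (P t)ᵀ = P t := fun t ht => (posSemidef_iff_quad.1 (hP t ht).2).1
  have hXsymm : ∀ t, 0 ≤ t → (X t)ᵀ = X t := fun t ht => (posSemidef_iff_quad.1 (hX t ht).2.1).1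
  have hlower : ∀ t, 0 ≤ t → ∀ x, quad (P t) x ≤ quad (X t) x := fun t ht x => by
    have h := quad_nonneg_of_comparison (E := fun τ => X τ - P τ)
      (fun τ hτ => (hX τ hτ).2.2.2.1)
      (fun τ hτ => ((hX τ hτ).1.sub (hP τ hτ).1).congr_deriv
        (riccati_sub_riccati (hXsymm τ hτ) (hPsymm τ hτ)))
      (fun τ _ x => quad_transpose_mul_self_nonneg _ x)
      (fun x => by simpa [hP0] using (posSemidef_iff_quad.1 (hX 0 le_rfl).2.1).2 x)
      ht (hX t ht).2.2.1 x
    rw [quad_sub] at h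
    linarith
  set F := A - B * Bᵀ * L with hF
  -- Comparison of `L - X` along the flow of `-F`, evaluated at `exp(tF) x` so that the final vector
  -- is `x`.
  have hupper : ∀ t, 0 ≤ t → ∀ x, quad (X t) x ≤
      quad L x - quad (L - X 0) (NormedSpace.exp (t • F) *ᵥ x) := fun t ht x => by
    have h := quad_comparison (E := fun τ => L - X τ)
      (fun τ _ => hasMatrixDeriv_exp_neg F τ)
      (fun τ hτ => ((HasMatrixDeriv.const L τ).sub (hX τ hτ).1).congr_deriv (by
        rw [hF, ← riccati_sub_riccati hLsymm (hXsymm τ hτ), hL]))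
      (fun τ _ x => quad_transpose_mul_self_nonneg _ x) (NormedSpace.exp (t • F) *ᵥ x) ht
    have hinv : NormedSpace.exp (t • (-F)) * NormedSpace.exp (t • F) = 1 := by
      rw [smul_neg, Matrix.exp_neg]
      exact Matrix.nonsing_inv_mul _ ((Matrix.isUnit_iff_isUnit_det _).1 (Matrix.isUnit_exp _))
    rw [Matrix.mulVec_mulVec x (NormedSpace.exp (t • (-F))), hinv, Matrix.one_mulVec, zero_smul,
      NormedSpace.exp_zero, Matrix.one_mulVec, quad_sub L (X t)] at h
    linarith
  refine tendsto_of_tendsto_quad hXsymm hLsymm fun x => ?_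
  have h1 : Tendsto (fun t => quad (P t) x) atTop (𝓝 (quad L x)) :=
    ((continuous_quad x).tendsto L).comp hPL
  have h2 : Tendsto (fun t : ℝ => quad L x - quad (L - X 0) (NormedSpace.exp (t • F) *ᵥ x)) atTop
      (𝓝 (quad L x)) := by
    have h := ((continuous_quad x).tendsto 0).comp
      (tendsto_transpose_mul_mul hstabL.tendsto_exp hstabL.tendsto_exp (L - X 0))
    have h0 : quad (0 : Matrix (Fin n) (Fin n) ℝ) x = 0 := by simp [quad]
    rw [h0] at h
    simpa [Function.comp_def, quad_conj] using h.const_sub (quad L x)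
  refine tendsto_of_tendsto_of_tendsto_of_le_of_le' h1 h2 ?_ ?_
  · filter_upwards [eventually_ge_atTop 0] with t ht using hlower t ht x
  · filter_upwards [eventually_ge_atTop 0] with t ht using hupper t ht x

/-- Existence, uniqueness and attractivity of the stabilizing solution. -/
theorem exists_stabilizing_attractor (hstab : IsStabilizable A B) (hdet : IsDetectable C A) :
    ∃ L : Matrix (Fin n) (Fin n) ℝ, (L.PosSemidef ∧ IsAlgebraicSolution A B C L ∧
      IsStabilizing A B L ∧
      ∀ X : Matrix (Fin n) (Fin n) ℝ, X.PosSemidef → IsAlgebraicSolution A B C X → X = L) ∧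
      ∀ (q : ℕ) (Z : Matrix (Fin n) (Fin q) ℝ),
        (∃ Y, IsDifferentialSolution A B C Z Y) ∧
        ∀ Y, IsDifferentialSolution A B C Z Y → Tendsto Y atTop (𝓝 L) := by
  obtain ⟨P, U, hP0, hP⟩ := exists_solution A B C (X₀ := 0) Matrix.PosSemidef.zero
  obtain ⟨L, hLpos, hL, hPL⟩ := hstab.exists_tendsto hP0 hP
  have hLstab := hdet.isStabilizing hLpos hL
  refine ⟨L, ⟨hLpos, hL, hLstab, fun X hX hXeq => ?_⟩, fun q Z => ?_⟩
  · exact hXeq.eq_of_isStabilizing (posSemidef_iff_quad.1 hX).1 hL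
      (hdet.isStabilizing hX hXeq) hLstab
  · have hZ : (Z * Zᵀ).PosSemidef := by
      simpa using Matrix.posSemidef_self_mul_conjTranspose Z
    obtain ⟨X, V, hX0, hX⟩ := exists_solution A B C hZ
    refine ⟨⟨X, hX0, fun t ht => (hX t ht).1⟩, fun Y hY => ?_⟩
    refine (tendsto_of_posSemidef hLpos hL hLstab hP0
      (fun t ht => ⟨(hP t ht).1, (hP t ht).2.1⟩) hPL hX).congr' ?_
    filter_upwards [eventually_ge_atTop 0] with t ht
    exact (solution_unique (hY.1.trans hX0.symm) (fun τ hτ => (hX τ hτ).1) hY.2 ht).symm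

end Riccati

/-! ### Orthogonal change of coordinates and the main theorem. -/

namespace Riccati

variable {n s p q : ℕ}

/-- Orthogonal change of coordinates in the Riccati operator. -/
theorem riccati_conj (A : Matrix (Fin n) (Fin n) ℝ) (B : Matrix (Fin n) (Fin s) ℝ)
    (C : Matrix (Fin p) (Fin n) ℝ) {V : Matrix (Fin n) (Fin n) ℝ} (hV : V * Vᵀ = 1)
    (X : Matrix (Fin n) (Fin n) ℝ) :
    riccati (Vᵀ * A * V) (Vᵀ * B) (C * V) (Vᵀ * X * V) = Vᵀ * riccati A B C X * V := by
  have h : ∀ M : Matrix (Fin n) (Fin n) ℝ, V * (Vᵀ * M) = M := fun M => by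
    rw [← Matrix.mul_assoc, hV, Matrix.one_mul]
  simp only [riccati, Matrix.transpose_mul, Matrix.transpose_transpose, mul_add, add_mul, mul_sub,
    sub_mul, Matrix.mul_assoc, h]

theorem IsDifferentialSolution.conj {A : Matrix (Fin n) (Fin n) ℝ} {B : Matrix (Fin n) (Fin s) ℝ}
    {C : Matrix (Fin p) (Fin n) ℝ} {Z : Matrix (Fin n) (Fin q) ℝ} {V : Matrix (Fin n) (Fin n) ℝ}
    (hV : V * Vᵀ = 1) {X : ℝ → Matrix (Fin n) (Fin n) ℝ} (hX : IsDifferentialSolution A B C Z X) :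
    IsDifferentialSolution (Vᵀ * A * V) (Vᵀ * B) (C * V) (Vᵀ * Z) (fun t => Vᵀ * X t * V) := by
  refine ⟨by simp [hX.1, Matrix.transpose_mul, Matrix.mul_assoc], fun t ht => ?_⟩
  refine HasMatrixDeriv.congr_deriv ?_ (riccati_conj A B C hV (X t)).symm
  exact (HasMatrixDeriv.const_mul Vᵀ (hX.2 t ht)).mul_const V

theorem IsDifferentialSolution.of_conj {A : Matrix (Fin n) (Fin n) ℝ}
    {B : Matrix (Fin n) (Fin s) ℝ} {C : Matrix (Fin p) (Fin n) ℝ} {Z : Matrix (Fin n) (Fin q) ℝ}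
    {V : Matrix (Fin n) (Fin n) ℝ} (hV : V * Vᵀ = 1) {Y : ℝ → Matrix (Fin n) (Fin n) ℝ}
    (hY : IsDifferentialSolution (Vᵀ * A * V) (Vᵀ * B) (C * V) (Vᵀ * Z) Y) :
    IsDifferentialSolution A B C Z (fun t => V * Y t * Vᵀ) := by
  have hV' : (Vᵀ) * (Vᵀ)ᵀ = 1 := by rw [Matrix.transpose_transpose, mul_eq_one_comm, hV]
  have h := hY.conj hV'
  have e : ∀ {k : ℕ} (M : Matrix (Fin n) (Fin k) ℝ), V * (Vᵀ * M) = M := fun M => by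
    rw [← Matrix.mul_assoc, hV, Matrix.one_mul]
  simpa [Matrix.mul_assoc, e, hV] using h

end Riccati

/-- `V` is the matrix of an orthonormal basis of the projection space, of dimension `d` a priori.
The reduced data are `Vᵀ A V`, `Vᵀ B`, `C V`, `Vᵀ Z`, and `Yinf` is the limit of the solution of
the reduced differential Riccati equation with initial value `(Vᵀ Z) (Vᵀ Z)ᵀ`. -/
theorem mainTheorem3 (n s p q d : ℕ)
    (A : Matrix (Fin n) (Fin n) ℝ) (B : Matrix (Fin n) (Fin s) ℝ)
    (C : Matrix (Fin p) (Fin n) ℝ) (Z : Matrix (Fin n) (Fin q) ℝ)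
    (hstab : Riccati.IsStabilizable A B) (hdet : Riccati.IsDetectable C A)
    (V : Matrix (Fin n) (Fin d) ℝ) (hV : Vᵀ * V = 1) (hfull : V.rank = n) :
    ∃ (Xinf : Matrix (Fin n) (Fin n) ℝ) (Yinf : Matrix (Fin d) (Fin d) ℝ),
      -- `Xinf` is a nonnegative definite stabilizing solution of the algebraic Riccati equation,
      -- and the only nonnegative definite one
      (Xinf.PosSemidef ∧ Riccati.IsAlgebraicSolution A B C Xinf ∧
        Riccati.IsStabilizing A B Xinf ∧
        ∀ X : Matrix (Fin n) (Fin n) ℝ,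
          X.PosSemidef → Riccati.IsAlgebraicSolution A B C X → X = Xinf) ∧
      -- the reduced differential equation is solvable on `[0, ∞)`, with limit `Yinf`
      (∃ Y : ℝ → Matrix (Fin d) (Fin d) ℝ,
        Riccati.IsDifferentialSolution (Vᵀ * A * V) (Vᵀ * B) (C * V) (Vᵀ * Z) Y) ∧
      (∀ Y : ℝ → Matrix (Fin d) (Fin d) ℝ,
        Riccati.IsDifferentialSolution (Vᵀ * A * V) (Vᵀ * B) (C * V) (Vᵀ * Z) Y →
          Filter.Tendsto Y Filter.atTop (nhds Yinf)) ∧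
      V * Yinf * Vᵀ = Xinf := by
  -- Orthonormal columns give `d ≤ V.rank`, and the rank never exceeds the number of columns.
  have hdn : d = n := by
    refine le_antisymm ?_ ?_
    · calc d = (Vᵀ * V).rank := by rw [hV, Matrix.rank_one, Fintype.card_fin]
        _ ≤ V.rank := Matrix.rank_mul_le_right _ _
        _ = n := hfull
    · rw [← hfull]
      exact Matrix.rank_le_width V
  subst hdn
  have hV' : V * Vᵀ = 1 := mul_eq_one_comm.1 hV
  obtain ⟨L, hL, hsol⟩ := Riccati.exists_stabilizing_attractor hstab hdet
  obtain ⟨⟨X, hX⟩, hconv⟩ := hsol q Z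
  refine ⟨L, Vᵀ * L * V, hL, ⟨_, hX.conj hV'⟩, fun Y hY => ?_, ?_⟩
  -- An arbitrary reduced solution lifts to a full one, whose limit is `L`; projecting back gives
  -- the reduced limit.
  · have hc : Continuous fun M : Matrix (Fin d) (Fin d) ℝ => Vᵀ * M * V := by fun_prop
    refine ((hc.tendsto L).comp (hconv _ (hY.of_conj hV'))).congr fun t => ?_
    calc Vᵀ * (V * Y t * Vᵀ) * V = (Vᵀ * V) * Y t * (Vᵀ * V) := by simp only [Matrix.mul_assoc]
      _ = Y t := by rw [hV, Matrix.one_mul, Matrix.mul_one]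
  · calc V * (Vᵀ * L * V) * Vᵀ = (V * Vᵀ) * L * (V * Vᵀ) := by simp only [Matrix.mul_assoc]
      _ = L := by rw [hV', Matrix.one_mul, Matrix.mul_one]
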